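/- **Lemma 2.2.** Let $V$ be a finite set, let $\mu$ be a probability distribution on $\{-1,+1\}^V$ with support $\Omega(\mu)$, and let $\eta>0$. For a distribution $\nu$ on $\{-1,+1\}^V$, $\Lambda\subseteq V$ and $\sigma\in\{-1,+1\}^\Lambda$ of positive $\nu$-probability, let $\nu^{\sigma}$ be $\nu$ conditioned on the configuration on $\Lambda$ being $\sigma$, and let $\Psi_\nu^{\sigma}\in\mathbb R^{(V\setminus\Lambda)\times(V\setminus\Lambda)}$ be the influence matrix with $\Psi_\nu^\sigma(u,u)=0$ and, for $u\ne v$, $$\Psi_\nu^{\sigma}(u,v)=\max_{c,c'}\, d_{\mathrm{TV}}\big(\nu_v^{\sigma,u\leftarrow c},\,\nu_v^{\sigma,u\leftarrow c'}\big),$$ where $c,c'$ range over the values that $u$ takes with positive probability under $\nu^\sigma$, $\nu_v^{\sigma,u\leftarrow c}$ is the marginal at $v$ of $\nu^\sigma$ further conditioned on $u$ having value $c$, and $d_{\mathrm{TV}}$ is the total variation distance. Call $\nu$ *$\eta$-spectrally independent* if the spectral radius of $\Psi_\nu^\sigma$ is at most $\eta$ for all such $\Lambda,\sigma$. For $\phi\in(0,\infty)^V$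 let $\mu^{(\phi)}$ be the distribution with $\mu^{(\phi)}(\sigma)\propto\mu(\sigma)\prod_{v:\sigma_v=+1}\phi_v$, and write $\mu^{(\theta)}$ when $\phi_v=\theta$ for all $v$. Call $\mu$ *completely $\eta$-spectrally independent* if $\mu^{(\phi)}$ is $\eta$-spectrally independent for every $\phi\in(0,1]^V$. For $\theta\in(0,1)$, the *field dynamics* for $\mu$ with parameter $\theta$ is the Markov chain on $\Omega(\mu)$ that updates a configuration $\sigma$ as follows: generate a random $S\subseteq V$ by selecting each $v\in V$ independently, with probability $1$ if $\sigma_v=-1$ and $\theta$ if $\sigma_v=+1$; then replace $\sigma_S$ by a sample from the marginal on $S$ of $\pi=\mu^{(\theta)}$ conditioned on $\sigma_{V\setminus S}$. This chain is reversible with respect to $\mu$; its *spectral gap* is $1-\lambda_2$, where $\lambda_2$ is the second largest eigenvalue, counted with multiplicity, of its transition matrix, with $\lambda_2=0$ if $|\Omega(\mu)|=1$. If $\mu$ is completely $\eta$-spectrally independent, then for every $\theta\in(0,1)$ the spectral gap of the field dynamics for $\mu$ with parameter $\theta$ is at least $$\left(\frac{\theta}{2}\right)^{2\eta+7}.$$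 -/

import Mathlib

/-! Distributions on `{-1,+1}^V` are real-valued functions `μ : (V → ℤˣ) → ℝ` (the theorem takes
`μ ∈ stdSimplex ℝ (V → ℤˣ)`); the two spins are the elements `1` and `-1` of `ℤˣ`. -/

namespace FieldDynamics

noncomputable section

variable {V : Type*} [Fintype V] [DecidableEq V]

/-- The marginal `μ_Λ` of `μ` on `Λ`. -/
def marginal (μ : (V → ℤˣ) → ℝ) (Λ : Finset V) (σ : Λ → ℤˣ) : ℝ :=
  ∑ τ : V → ℤˣ with ∀ v : Λ, τ v = σ v, μ τ

/-- The distribution `μ^σ` on `{-1,+1}^V`: `μ` conditioned on the configuration on `Λ` being `σ`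
(used only when `0 < μ_Λ(σ)`). -/
def pinned (μ : (V → ℤˣ) → ℝ) (Λ : Finset V) (σ : Λ → ℤˣ) (τ : V → ℤˣ) : ℝ :=
  if ∀ v : Λ, τ v = σ v then μ τ / marginal μ Λ σ else 0

/-- The marginal `μ_v` of `μ` at the single variable `v`. -/
def marginalAt (μ : (V → ℤˣ) → ℝ) (v : V) (c : ℤˣ) : ℝ :=
  ∑ τ : V → ℤˣ with τ v = c, μ τ

/-- The distribution `μ^{u ← c}`: `μ` conditioned on the value of `u` being `c`
(used only when `0 < μ_u(c)`). -/
def pinnedAt (μ : (V → ℤˣ) → ℝ) (u : V) (c : ℤˣ) (τ : V → ℤˣ) : ℝ :=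
  if τ u = c then μ τ / marginalAt μ u c else 0

/-- Total variation distance of two distributions on a finite set. -/
def dTV {α : Type*} [Fintype α] (p q : α → ℝ) : ℝ :=
  (1 / 2) * ∑ x, |p x - q x|

/-- The (absolute) influence matrix `Ψ_μ^σ`, indexed by `V \ Λ`: its diagonal vanishes, and for
`u ≠ v` its entry is the maximum, over the values `c, c'` in the support of `μ^σ_u`, of the total
variation distance between the marginals at `v` of `μ^{σ, u ← c}` and `μ^{σ, u ← c'}`. -/
def influence (μ : (V → ℤˣ) → ℝ) (Λ : Finset V) (σ : Λ → ℤˣ) :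
    Matrix {v : V // v ∉ Λ} {v : V // v ∉ Λ} ℝ :=
  Matrix.of fun u v =>
    if u = v then 0
    else ⨆ p : {p : ℤˣ × ℤˣ // 0 < marginalAt (pinned μ Λ σ) u.1 p.1 ∧
        0 < marginalAt (pinned μ Λ σ) u.1 p.2},
      dTV (marginalAt (pinnedAt (pinned μ Λ σ) u.1 p.1.1) v.1)
        (marginalAt (pinnedAt (pinned μ Λ σ) u.1 p.1.2) v.1)

/-- `η`-spectral independence: for every `Λ ⊆ V` and every feasible `σ` on `Λ`, the spectral radius
(largest modulus of a complex eigenvalue) of the influence matrix is at most `η`. -/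
def SpectrallyIndependent (μ : (V → ℤˣ) → ℝ) (η : ℝ) : Prop :=
  ∀ (Λ : Finset V) (σ : Λ → ℤˣ), 0 < marginal μ Λ σ →
    spectralRadius ℂ ((influence μ Λ σ).map (fun x : ℝ => (x : ℂ))) ≤ ENNReal.ofReal η

/-- The distribution `μ^{(φ)}`, proportional to `μ(σ) ∏_{v : σ_v = +1} φ_v`. -/
def magnetize (μ : (V → ℤˣ) → ℝ) (φ : V → ℝ) (σ : V → ℤˣ) : ℝ :=
  (μ σ * ∏ v with σ v = 1, φ v) / ∑ τ : V → ℤˣ, μ τ * ∏ v with τ v = 1, φ v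

/-- Complete `η`-spectral independence. -/
def CompletelySpectrallyIndependent (μ : (V → ℤˣ) → ℝ) (η : ℝ) : Prop :=
  ∀ φ : V → ℝ, (∀ v, 0 < φ v ∧ φ v ≤ 1) → SpectrallyIndependent (magnetize μ φ) η

/-- The probability `p_v` with which the field dynamics selects `v` for resampling when the current
configuration is `σ`. -/
def selectProb (θ : ℝ) (σ : V → ℤˣ) (v : V) : ℝ :=
  if σ v = -1 then 1 else θ

/-- The transition matrix, on the support of `μ`, of the field dynamics with parameter `θ`. From
`σ`, a random set `S` containing each `v` independently with probability `p_v` is generated, and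
`σ_S` is resampled from `π = μ^{(θ)}` conditioned on `σ_{V \ S}`. Since `π^{σ_{V \ S}}` is carried by
the configurations that agree with `σ` on `V \ S`, this is a sample of `π^{σ_{V \ S}}`. -/
def fieldDynamics (μ : (V → ℤˣ) → ℝ) (θ : ℝ) :
    Matrix {σ : V → ℤˣ // 0 < μ σ} {σ : V → ℤˣ // 0 < μ σ} ℝ :=
  Matrix.of fun σ τ =>
    ∑ S : Finset V,
      ((∏ v ∈ S, selectProb θ σ.1 v) * ∏ v ∈ Sᶜ, (1 - selectProb θ σ.1 v)) *
        pinned (magnetize μ fun _ => θ) Sᶜ (fun v => σ.1 v) τ.1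

/-- The second largest eigenvalue `λ₂`, where the eigenvalues are counted with their algebraic
multiplicities and sorted in decreasing order; `λ₂ = 0` if the state space has only one point.
(Transition matrices of reversible chains have only real eigenvalues.) -/
def secondEigenvalue {Ω : Type*} [Fintype Ω] [DecidableEq Ω] (P : Matrix Ω Ω ℝ) : ℝ :=
  (P.charpoly.roots.sort (· ≥ ·)).getD 1 0

/-- The spectral gap `1 - λ₂` of a reversible Markov chain. -/
def spectralGap {Ω : Type*} [Fintype Ω] [DecidableEq Ω] (P : Matrix Ω Ω ℝ) : ℝ :=
  1 - secondEigenvalue P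

end

end FieldDynamics

/-! Let `R` be the complement of the resampled set `S`. Only `+1` spins can be left out of `S`, so
`R` is a random subset of the `+1` spins of `σ`, each kept with probability `1 - θ`, and the new
configuration is drawn from the law of `σ` given that `R` is revealed to be `+1`. Hence `⟨f, P f⟩ =
E[E[f | R]²]`, which is `projSq μ f θ` (`quadForm_fieldDynamics`).

Let the parameter `t` run from `1`, where nothing is revealed, down to `θ`. The second moment
`projSq` grows at a rate given by the squared jumps of the conditional mean when one more `+1` is
revealed (`hasDerivAt_projSq`). Given `R`, the configuration has law `μ^{(t)}` pinned to `+1` on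
`R`, so spectral independence bounds its covariance matrix, and `t` times the rate is at most `1 +
η` times the remaining variance (`sum_tiltSum_insert_mul_sq_le`). By Grönwall, `t ^ (-(1 + η))`
times the remaining variance is antitone in `t`; comparing `t = 1` with `t = θ` leaves at least a
fraction `θ ^ (1 + η)` of the variance. The gap is thus at least `θ ^ (1 + η)`, stronger than the
stated bound. -/

namespace FieldDynamics

/-! ### Spectral radii and quadratic forms. -/

section SpectralBound

variable {ι : Type*} [Fintype ι] [DecidableEq ι]

theorem norm_pow_apply_le {A : Matrix ι ι ℂ} {P : Matrix ι ι ℝ} (h : ∀ i j, ‖A i j‖ ≤ P i j)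
    (n : ℕ) (i j : ι) : ‖(A ^ n) i j‖ ≤ (P ^ n) i j := by
  induction n generalizing i j with
  | zero =>
    by_cases hij : i = j
    · subst hij; simp
    · simp [Matrix.one_apply_ne hij]
  | succ n ih =>
    rw [pow_succ, pow_succ, Matrix.mul_apply, Matrix.mul_apply]
    refine (norm_sum_le _ _).trans (Finset.sum_le_sum fun k _ => ?_)
    rw [norm_mul]
    exact mul_le_mul (ih i k) (h k j) (norm_nonneg _) ((norm_nonneg _).trans (ih i k))

attribute [local instance] Matrix.linftyOpNormedRing Matrix.linftyOpNormedAlgebra in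
/-- Monotonicity of the spectral radius: an entrywise bound on moduli bounds spectral radii. -/
theorem spectralRadius_le_of_norm_apply_le {A : Matrix ι ι ℂ} {P : Matrix ι ι ℝ}
    (h : ∀ i j, ‖A i j‖ ≤ P i j) :
    spectralRadius ℂ A ≤ spectralRadius ℂ (P.map (fun x : ℝ => (x : ℂ))) := by
  have hc : CompleteSpace (Matrix ι ι ℂ) := FiniteDimensional.complete ℂ _
  -- Gelfand's formula, in the maximal row sum norm because that norm is monotone in the moduli of
  -- the entries.
  refine le_of_tendsto_of_tendsto' (spectrum.pow_nnnorm_pow_one_div_tendsto_nhds_spectralRadius A)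
    (spectrum.pow_nnnorm_pow_one_div_tendsto_nhds_spectralRadius _) fun n => ?_
  refine ENNReal.rpow_le_rpow (ENNReal.coe_le_coe.2 ?_) (by positivity)
  rw [Matrix.linfty_opNNNorm_def, Matrix.linfty_opNNNorm_def]
  refine Finset.sup_mono_fun fun i _ => Finset.sum_le_sum fun j _ => ?_
  have hmap : (P.map (fun x : ℝ => (x : ℂ))) ^ n = (P ^ n).map (fun x : ℝ => (x : ℂ)) :=
    (map_pow (RingHom.mapMatrix (m := ι) Complex.ofRealHom) P n).symm
  rw [hmap, Matrix.map_apply, ← NNReal.coe_le_coe, coe_nnnorm, coe_nnnorm, Complex.norm_real]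
  exact (norm_pow_apply_le h n i j).trans (le_abs_self _)

theorem spectralRadius_one_add_le {A : Matrix ι ι ℂ} {η : ℝ} (hη : 0 ≤ η)
    (h : spectralRadius ℂ A ≤ ENNReal.ofReal η) :
    spectralRadius ℂ (1 + A) ≤ ENNReal.ofReal (1 + η) := by
  refine iSup₂_le fun k hk => ?_
  rw [← map_one (algebraMap ℂ (Matrix ι ι ℂ)), ← spectrum.singleton_add_eq] at hk
  obtain ⟨z, hz, rfl⟩ : ∃ z ∈ spectrum ℂ A, 1 + z = k := by
    obtain ⟨o, ho, z, hz, hk⟩ := Set.mem_add.1 hk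
    exact ⟨z, hz, by rw [← hk, Set.mem_singleton_iff.1 ho]⟩
  have h1 : (‖z‖₊ : ENNReal) ≤ ENNReal.ofReal η :=
    (le_iSup₂ (f := fun k (_ : k ∈ spectrum ℂ A) => (‖k‖₊ : ENNReal)) z hz).trans h
  rw [ENNReal.ofReal_add zero_le_one hη, ENNReal.ofReal_one]
  calc (‖1 + z‖₊ : ENNReal) ≤ ((‖(1 : ℂ)‖₊ + ‖z‖₊ : NNReal) : ENNReal) :=
        ENNReal.coe_le_coe.2 (nnnorm_add_le _ _)
    _ ≤ 1 + ENNReal.ofReal η := by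
        rw [nnnorm_one, ENNReal.coe_add, ENNReal.coe_one]; gcongr

theorem spectralRadius_diagonal_conj (A : Matrix ι ι ℂ) (d : ι → ℂ) (hd : ∀ i, d i ≠ 0) :
    spectralRadius ℂ (Matrix.of fun i j => d i * A i j * (d j)⁻¹) = spectralRadius ℂ A := by
  let U : (Matrix ι ι ℂ)ˣ :=
    { val := Matrix.diagonal d
      inv := Matrix.diagonal fun i => (d i)⁻¹
      val_inv := by simp [Matrix.diagonal_mul_diagonal, hd]
      inv_val := by simp [Matrix.diagonal_mul_diagonal, hd] }
  have : (Matrix.of fun i j => d i * A i j * (d j)⁻¹) = (U : Matrix ι ι ℂ) * A *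
      ((U⁻¹ : (Matrix ι ι ℂ)ˣ) : Matrix ι ι ℂ) := by
    ext i j
    change _ = (Matrix.diagonal d * A * Matrix.diagonal fun i => (d i)⁻¹) i j
    simp [Matrix.mul_diagonal, Matrix.diagonal_mul]
  rw [spectralRadius, spectralRadius, this, spectrum.units_conjugate]

-- For a self-adjoint matrix the spectral radius equals the `ℓ²` operator norm, and Cauchy–Schwarz
-- does the rest.
open scoped Matrix.Norms.L2Operator in
theorem quadForm_le_of_spectralRadius_le {B : Matrix ι ι ℝ} (hB : B.transpose = B) {r : ℝ}
    (hr : 0 ≤ r)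
    (h : spectralRadius ℂ (B.map (fun x : ℝ => (x : ℂ))) ≤ ENNReal.ofReal r) (y : ι → ℝ) :
    ∑ u, ∑ v, y u * y v * B u v ≤ r * ∑ u, y u ^ 2 := by
  set M := B.map (fun x : ℝ => (x : ℂ)) with hM
  have hsa : IsSelfAdjoint M := by
    rw [IsSelfAdjoint, Matrix.star_eq_conjTranspose]
    ext i j
    have := congrFun (congrFun hB i) j
    rw [Matrix.transpose_apply] at this
    simp [hM, this]
  have hn : ‖M‖ ≤ r := by
    rw [hsa.spectralRadius_eq_nnnorm, ENNReal.ofReal, ENNReal.coe_le_coe] at h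
    have := NNReal.coe_le_coe.2 h
    rwa [coe_nnnorm, Real.coe_toNNReal _ hr] at this
  let z : EuclideanSpace ℂ ι := WithLp.toLp 2 fun i => (y i : ℂ)
  have hz : ‖z‖ ^ 2 = ∑ u, y u ^ 2 := by
    rw [EuclideanSpace.norm_sq_eq]
    simp [z]
  have hin : inner ℂ z (WithLp.toLp 2 (M.mulVec z.ofLp) : EuclideanSpace ℂ ι) =
      ((∑ u, ∑ v, y u * y v * B u v : ℝ) : ℂ) := by
    simp only [PiLp.inner_apply, z, Matrix.mulVec, dotProduct, hM, Matrix.map_apply]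
    push_cast
    refine Finset.sum_congr rfl fun u _ => ?_
    simp only [RCLike.inner_apply, Complex.conj_ofReal, Finset.sum_mul]
    exact Finset.sum_congr rfl fun v _ => by ring
  have h1 := norm_inner_le_norm (𝕜 := ℂ) z (WithLp.toLp 2 (M.mulVec z.ofLp) : EuclideanSpace ℂ ι)
  rw [hin, Complex.norm_real] at h1
  have h2 := Matrix.l2_opNorm_mulVec M z
  calc ∑ u, ∑ v, y u * y v * B u v ≤ ‖z‖ * ‖(WithLp.toLp 2 (M.mulVec z.ofLp) : EuclideanSpace ℂ ι)‖ :=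
        (le_abs_self _).trans h1
    _ ≤ ‖z‖ * (r * ‖z‖) := by
        gcongr
        exact h2.trans (by gcongr)
    _ = r * ∑ u, y u ^ 2 := by rw [← hz]; ring

/-- A symmetric matrix whose rows, divided by the weights `p`, are dominated entrywise by `1 + Ψ` is
at most `1 + ρ(Ψ)` times the diagonal matrix of weights. -/
theorem quadForm_le_of_abs_le {C Ψ : Matrix ι ι ℝ} {p : ι → ℝ} (hC : C.transpose = C)
    (hp : ∀ u, 0 ≤ p u) (h : ∀ u v, |C u v| ≤ p u * (1 + Ψ) u v)
    {η : ℝ} (hη : 0 ≤ η) (hΨη : spectralRadius ℂ (Ψ.map (fun x : ℝ => (x : ℂ))) ≤ ENNReal.ofReal η)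
    (hΨ : ∀ u v, 0 ≤ Ψ u v) (x : ι → ℝ) :
    ∑ u, ∑ v, x u * x v * C u v ≤ (1 + η) * ∑ u, p u * x u ^ 2 := by
  have hsymm : ∀ u v, C u v = C v u := fun u v => congrFun (congrFun hC v) u
  have hC0 : ∀ u v, p u = 0 → C u v = 0 := fun u v hu => by
    have := h u v
    rw [hu, zero_mul] at this
    exact abs_eq_zero.1 (le_antisymm this (abs_nonneg _))
  -- The value `1` at zero weights keeps the diagonal scaling invertible; it is harmless since `C`
  -- vanishes on those rows and columns.
  let d : ι → ℝ := fun u => if p u = 0 then 1 else √(p u)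
  have hd : ∀ u, 0 < d u := fun u => by
    by_cases hu : p u = 0
    · simp [d, hu]
    · simpa [d, hu] using lt_of_le_of_ne (hp u) (Ne.symm hu)
  have hone : ∀ u v, 0 ≤ (1 + Ψ) u v := fun u v => by
    rw [Matrix.add_apply, Matrix.one_apply]
    have := hΨ u v
    split_ifs <;> linarith
  let B : Matrix ι ι ℝ := Matrix.of fun u v => C u v / (d u * d v)
  have hB : B.transpose = B := by
    ext u v
    simp only [B, Matrix.transpose_apply, Matrix.of_apply, hsymm v u, mul_comm]
  -- The symmetric normalisation of `C` is dominated by a diagonal conjugate of `1 + Ψ`, and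
  -- conjugation preserves the spectral radius.
  have hle : ∀ u v, ‖(B.map (fun x : ℝ => (x : ℂ))) u v‖ ≤
      (Matrix.of fun i j => d i * (1 + Ψ) i j * (d j)⁻¹) u v := fun u v => by
    simp only [Matrix.map_apply, Complex.norm_real, Real.norm_eq_abs, B, Matrix.of_apply]
    rw [abs_div, abs_of_pos (mul_pos (hd u) (hd v)), div_le_iff₀ (mul_pos (hd u) (hd v))]
    have hv := (hd v).ne'
    have he : d u * (1 + Ψ) u v * (d v)⁻¹ * (d u * d v) = d u * d u * (1 + Ψ) u v := by
      field_simp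
    rw [he]
    by_cases hu : p u = 0
    · rw [hC0 u v hu, abs_zero]
      exact mul_nonneg (mul_self_nonneg _) (hone u v)
    · have : d u * d u = p u := by simp [d, hu, Real.mul_self_sqrt (hp u)]
      rw [this]
      exact h u v
  have hmap : (Matrix.of fun i j => d i * (1 + Ψ) i j * (d j)⁻¹).map (fun x : ℝ => (x : ℂ)) =
      Matrix.of fun i j => (d i : ℂ) * (1 + Ψ.map (fun x : ℝ => (x : ℂ))) i j * (d j : ℂ)⁻¹ := by
    ext i j
    by_cases hij : i = j <;> simp [hij, Matrix.one_apply]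
  have hρ := spectralRadius_le_of_norm_apply_le hle
  rw [hmap, spectralRadius_diagonal_conj _ _ fun i => by exact_mod_cast (hd i).ne'] at hρ
  have key := quadForm_le_of_spectralRadius_le hB (by linarith)
    (hρ.trans (spectralRadius_one_add_le hη hΨη)) fun u => √(p u) * x u
  simp only [mul_pow, Real.sq_sqrt (hp _)] at key
  convert key using 1
  refine Finset.sum_congr rfl fun u _ => Finset.sum_congr rfl fun v _ => ?_
  by_cases hu : p u = 0
  · simp [hu, hC0 u v hu]
  by_cases hv : p v = 0
  · simp [hv, hsymm u v, hC0 v u hv]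
  have h1 := (hd u).ne'
  have h2 := (hd v).ne'
  simp only [d, hu, hv, if_false] at h1 h2
  simp only [B, d, Matrix.of_apply, hu, hv, if_false]
  field_simp

end SpectralBound

/-! ### Revealing `+1` spins one at a time. -/

section Localization

variable {V : Type*} [Fintype V] [DecidableEq V]

/-- The tilt `∏_{v ∈ R} 𝟙[σ v = 1] * ∏_{v ∉ R : σ v = 1} θ` of a configuration when the variables of
`R` are revealed to be `1` and the remaining ones carry the external field `θ`. -/
noncomputable def tilt (θ : ℝ) (R : Finset V) (σ : V → ℤˣ) : ℝ :=
  (∏ v ∈ R, if σ v = 1 then 1 else 0) * ∏ v ∈ Rᶜ, if σ v = 1 then θ else 1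

/-- The total mass of a weight function `g` after tilting. -/
noncomputable def tiltSum (g : (V → ℤˣ) → ℝ) (θ : ℝ) (R : Finset V) : ℝ :=
  ∑ σ, g σ * tilt θ R σ

theorem tilt_nonneg {θ : ℝ} (hθ : 0 ≤ θ) (R : Finset V) (σ : V → ℤˣ) : 0 ≤ tilt θ R σ := by
  refine mul_nonneg (Finset.prod_nonneg fun v _ => ?_) (Finset.prod_nonneg fun v _ => ?_) <;>
  split_ifs <;> linarith

theorem tilt_one_empty (σ : V → ℤˣ) : tilt 1 ∅ σ = 1 := by
  simp [tilt]

/-- Revealing `v` trades the field factor `θ` for the indicator of `σ v = 1`. -/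
theorem tilt_insert (θ : ℝ) {R : Finset V} {v : V} (hv : v ∉ R) (σ : V → ℤˣ) :
    θ * tilt θ (insert v R) σ = if σ v = 1 then tilt θ R σ else 0 := by
  have h : (insert v R)ᶜ = Rᶜ.erase v := by ext; simp
  have hv' : v ∈ Rᶜ := by simpa using hv
  rw [tilt, tilt, Finset.prod_insert hv, h,
    ← Finset.mul_prod_erase Rᶜ (fun v => if σ v = 1 then θ else 1) hv']
  split_ifs <;> ring

theorem hasDerivAt_tilt (θ : ℝ) (R : Finset V) (σ : V → ℤˣ) :
    HasDerivAt (fun t => tilt t R σ) (∑ v ∈ Rᶜ, tilt θ (insert v R) σ) θ := by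
  have h := (HasDerivAt.fun_finsetProd (u := Rᶜ) (x := θ)
    (f := fun v t => if σ v = 1 then t else 1) (f' := fun v => if σ v = 1 then 1 else 0)
    fun v _ => by
      by_cases hv : σ v = 1
      · simpa [hv] using hasDerivAt_id' θ
      · simpa [hv] using hasDerivAt_const θ (1 : ℝ)).const_mul
      (∏ v ∈ R, if σ v = 1 then (1 : ℝ) else 0)
  refine h.congr_deriv ?_
  rw [Finset.mul_sum]
  refine Finset.sum_congr rfl fun v hv => ?_
  have h : (insert v R)ᶜ = Rᶜ.erase v := by ext; simp
  rw [tilt, Finset.prod_insert (by simpa using hv), h, smul_eq_mul]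
  ring

/-- The summands are the law of `R` given `σ`. Each `+1` spin contributes `(1 - θ) + θ` and each
`-1` spin contributes `0 + 1`; expand the product. -/
theorem sum_tilt (θ : ℝ) (σ : V → ℤˣ) : ∑ R : Finset V, (1 - θ) ^ R.card * tilt θ R σ = 1 := by
  have h := Finset.prod_add (fun v => (1 - θ) * if σ v = 1 then 1 else 0)
    (fun v => if σ v = 1 then θ else 1) Finset.univ
  rw [Finset.prod_eq_one fun v _ => by split_ifs <;> ring, Finset.powerset_univ] at h
  refine Eq.trans ?_ h.symm
  refine Finset.sum_congr rfl fun R _ => ?_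
  rw [tilt, Finset.prod_mul_distrib, Finset.prod_const, ← Finset.compl_eq_univ_sdiff, mul_assoc]

theorem hasDerivAt_tiltSum (g : (V → ℤˣ) → ℝ) (θ : ℝ) (R : Finset V) :
    HasDerivAt (fun t => tiltSum g t R) (∑ v ∈ Rᶜ, tiltSum g θ (insert v R)) θ := by
  have h := HasDerivAt.fun_sum (u := Finset.univ) fun σ _ => (hasDerivAt_tilt θ R σ).const_mul (g σ)
  refine h.congr_deriv ?_
  simp only [tiltSum, Finset.mul_sum]
  exact Finset.sum_comm

theorem mul_tiltSum_insert (g : (V → ℤˣ) → ℝ) (θ : ℝ) {R : Finset V} {v : V} (hv : v ∉ R) :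
    θ * tiltSum g θ (insert v R) = ∑ σ, if σ v = 1 then g σ * tilt θ R σ else 0 := by
  rw [tiltSum, Finset.mul_sum]
  refine Finset.sum_congr rfl fun σ _ => ?_
  rw [mul_left_comm, tilt_insert θ hv]
  split_ifs <;> simp

theorem sum_tiltSum (g : (V → ℤˣ) → ℝ) (θ : ℝ) :
    ∑ R : Finset V, (1 - θ) ^ R.card * tiltSum g θ R = ∑ σ, g σ := by
  simp only [tiltSum, Finset.mul_sum]
  rw [Finset.sum_comm]
  refine Finset.sum_congr rfl fun σ _ => ?_
  simp only [mul_left_comm _ (g σ)]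
  rw [← Finset.mul_sum, sum_tilt, mul_one]

theorem tiltSum_nonneg {μ : (V → ℤˣ) → ℝ} (hμ : ∀ σ, 0 ≤ μ σ) {θ : ℝ} (hθ : 0 ≤ θ) (R : Finset V) :
    0 ≤ tiltSum μ θ R :=
  Finset.sum_nonneg fun σ _ => mul_nonneg (hμ σ) (tilt_nonneg hθ R σ)

theorem tiltSum_mul_eq_zero {μ : (V → ℤˣ) → ℝ} (hμ : ∀ σ, 0 ≤ μ σ) {θ : ℝ} (hθ : 0 ≤ θ)
    {R : Finset V} (h : tiltSum μ θ R = 0) (f : (V → ℤˣ) → ℝ) :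
    tiltSum (fun σ => μ σ * f σ) θ R = 0 := by
  have h0 := (Finset.sum_eq_zero_iff_of_nonneg
    fun σ _ => mul_nonneg (hμ σ) (tilt_nonneg hθ R σ)).1 h
  refine Finset.sum_eq_zero fun σ hσ => ?_
  rw [mul_right_comm, h0 σ hσ, zero_mul]

theorem tilt_eq_zero_iff {θ : ℝ} (hθ : θ ≠ 0) (R : Finset V) (σ : V → ℤˣ) :
    tilt θ R σ = 0 ↔ ¬ ∀ v ∈ R, σ v = 1 := by
  simp only [tilt, mul_eq_zero, Finset.prod_eq_zero_iff]
  constructor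
  · rintro (⟨v, hv, h⟩ | ⟨v, hv, h⟩)
    · exact fun hR => by simp [hR v hv] at h
    · split_ifs at h
      · exact absurd h hθ
      · exact absurd h one_ne_zero
  · intro h
    push Not at h
    obtain ⟨v, hv, h⟩ := h
    exact Or.inl ⟨v, hv, if_neg h⟩

theorem tiltSum_eq_zero_of_eq_zero {μ : (V → ℤˣ) → ℝ} (hμ : ∀ σ, 0 ≤ μ σ) {θ : ℝ} (hθ : 0 < θ)
    {R : Finset V} (h : tiltSum μ θ R = 0) {t : ℝ} (ht : 0 < t) : tiltSum μ t R = 0 := by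
  have h0 := (Finset.sum_eq_zero_iff_of_nonneg
    fun σ _ => mul_nonneg (hμ σ) (tilt_nonneg hθ.le R σ)).1 h
  refine Finset.sum_eq_zero fun σ hσ => ?_
  rcases mul_eq_zero.1 (h0 σ hσ) with h | h
  · rw [h, zero_mul]
  · rw [(tilt_eq_zero_iff ht.ne' R σ).2 ((tilt_eq_zero_iff hθ.ne' R σ).1 h), mul_zero]

theorem tiltSum_insert_eq_zero {μ : (V → ℤˣ) → ℝ} (hμ : ∀ σ, 0 ≤ μ σ) {θ : ℝ} (hθ : 0 < θ)
    {R : Finset V} (h : tiltSum μ θ R = 0) {v : V} (hv : v ∉ R) :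
    tiltSum μ θ (insert v R) = 0 := by
  have h0 := (Finset.sum_eq_zero_iff_of_nonneg
    fun σ _ => mul_nonneg (hμ σ) (tilt_nonneg hθ.le R σ)).1 h
  have := mul_tiltSum_insert μ θ hv
  rw [Finset.sum_eq_zero fun σ hσ => by rw [h0 σ hσ, ite_self]] at this
  exact (mul_eq_zero.1 this).resolve_left hθ.ne'

/-- The second moment of the conditional mean of `f` given the revealed set `R`. -/
noncomputable def projSq (μ f : (V → ℤˣ) → ℝ) (θ : ℝ) : ℝ :=
  ∑ R : Finset V, (1 - θ) ^ R.card *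
    (tiltSum (fun σ => μ σ * f σ) θ R ^ 2 / tiltSum μ θ R)

/-- Double counting of pairs `v ∈ R`, reindexed by `R.erase v`. It aligns the derivative of the
weights `(1 - θ) ^ R.card` with that of the tilted sums. -/
theorem sum_card_mul_eq_sum_insert (a : Finset V → ℝ) (s : ℝ) :
    ∑ R : Finset V, (R.card : ℝ) * s ^ (R.card - 1) * a R =
      ∑ R : Finset V, s ^ R.card * ∑ v ∈ Rᶜ, a (insert v R) := by
  have h1 : ∀ R : Finset V, (R.card : ℝ) * s ^ (R.card - 1) * a R =
      ∑ _v ∈ R, s ^ (R.card - 1) * a R := fun R => by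
    rw [Finset.sum_const, nsmul_eq_mul, mul_assoc]
  simp only [h1, Finset.mul_sum]
  rw [Finset.sum_sigma', Finset.sum_sigma']
  refine Finset.sum_bij' (fun x _ => ⟨x.1.erase x.2, x.2⟩) (fun x _ => ⟨insert x.2 x.1, x.2⟩)
    ?_ ?_ ?_ ?_ ?_
  · rintro ⟨R, v⟩ h; simp
  · rintro ⟨R, v⟩ h; simp
  · rintro ⟨R, v⟩ h
    have : v ∈ R := by simpa using h
    simp [Finset.insert_erase this]
  · rintro ⟨R, v⟩ h
    have : v ∉ R := by simpa using h
    simp [Finset.erase_insert this]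
  · rintro ⟨R, v⟩ h
    have : v ∈ R := by simpa using h
    simp [Finset.insert_erase this, Finset.card_erase_of_mem this]

/-- Write `N`, `Z` for the sums at `R` and `N'`, `Z'` for those at `insert v R`. The weights
contribute `-N'² / Z'` and the quotients `2 N N' / Z - N² Z' / Z²`; together these complete the
square `-Z' (N' / Z' - N / Z)²`. -/
theorem hasDerivAt_projSq {μ : (V → ℤˣ) → ℝ} (hμ : ∀ σ, 0 ≤ μ σ) (f : (V → ℤˣ) → ℝ) {θ : ℝ}
    (hθ : 0 < θ) :
    HasDerivAt (projSq μ f)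
      (-∑ R : Finset V, (1 - θ) ^ R.card * ∑ v ∈ Rᶜ, tiltSum μ θ (insert v R) *
        (tiltSum (fun σ => μ σ * f σ) θ (insert v R) / tiltSum μ θ (insert v R) -
          tiltSum (fun σ => μ σ * f σ) θ R / tiltSum μ θ R) ^ 2) θ := by
  set Z := tiltSum μ with hZ
  set N := tiltSum (fun σ => μ σ * f σ) with hN
  have hquot : ∀ R : Finset V, HasDerivAt (fun t => N t R ^ 2 / Z t R)
      (∑ v ∈ Rᶜ, (2 * N θ R * N θ (insert v R) / Z θ R -
        N θ R ^ 2 * Z θ (insert v R) / Z θ R ^ 2)) θ := fun R => by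
    by_cases h0 : Z θ R = 0
    -- The zero set of the tilt does not depend on the positive field, so `Z` vanishes near `θ` and
    -- the quotient takes the value `0` of division by zero.
    · have hev : (fun t => N t R ^ 2 / Z t R) =ᶠ[nhds θ] fun _ => 0 := by
        filter_upwards [lt_mem_nhds hθ] with t ht
        rw [hZ, tiltSum_eq_zero_of_eq_zero hμ hθ h0 ht, div_zero]
      refine ((hasDerivAt_const θ (0 : ℝ)).congr_of_eventuallyEq hev).congr_deriv ?_
      simp [h0]
    · refine (((hasDerivAt_tiltSum _ θ R).pow 2).div (hasDerivAt_tiltSum μ θ R) h0).congr_deriv ?_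
      rw [Finset.sum_sub_distrib, ← Finset.sum_div, ← Finset.sum_div, ← Finset.mul_sum,
        ← Finset.mul_sum]
      simp only [← hZ, ← hN, Pi.pow_apply]
      field_simp
      push_cast
      ring
  have h1 := HasDerivAt.fun_sum (u := (Finset.univ : Finset (Finset V))) fun R _ =>
    ((((hasDerivAt_id θ).const_sub 1).pow R.card).mul (hquot R))
  refine h1.congr_deriv ?_
  simp only [Pi.pow_apply, id]
  rw [Finset.sum_add_distrib]
  have h2 := sum_card_mul_eq_sum_insert (fun R => N θ R ^ 2 / Z θ R) (1 - θ)
  have h3 : ∑ R : Finset V, (R.card : ℝ) * (1 - θ) ^ (R.card - 1) * -1 * (N θ R ^ 2 / Z θ R) =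
      -∑ R : Finset V, (R.card : ℝ) * (1 - θ) ^ (R.card - 1) * (N θ R ^ 2 / Z θ R) := by
    rw [← Finset.sum_neg_distrib]
    exact Finset.sum_congr rfl fun R _ => by ring
  rw [h3, h2, ← Finset.sum_neg_distrib, ← Finset.sum_neg_distrib, ← Finset.sum_add_distrib]
  refine Finset.sum_congr rfl fun R _ => ?_
  rw [← mul_neg, ← mul_neg, ← mul_add, ← Finset.sum_neg_distrib, ← Finset.sum_neg_distrib,
    ← Finset.sum_add_distrib]
  congr 1
  refine Finset.sum_congr rfl fun v hv => ?_
  have hv' : v ∉ R := by simpa using hv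
  by_cases hv0 : Z θ (insert v R) = 0
  · have := tiltSum_mul_eq_zero hμ hθ.le hv0 f
    rw [← hN] at this
    simp [hv0, this]
  · have hR0 : Z θ R ≠ 0 := fun h => hv0 (tiltSum_insert_eq_zero hμ hθ h hv')
    field_simp
    ring

end Localization

/-! ### From a Poincaré inequality to the second eigenvalue. -/

section Gap

variable {Ω : Type*} [Fintype Ω] [DecidableEq Ω]

theorem charpoly_diagonal_conj (P : Matrix Ω Ω ℝ) (d : Ω → ℝ) (hd : ∀ i, d i ≠ 0) :
    (Matrix.of fun i j => d i * P i j * (d j)⁻¹).charpoly = P.charpoly := by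
  have : (Matrix.of fun i j => d i * P i j * (d j)⁻¹) =
      Matrix.diagonal d * P * Matrix.diagonal fun i => (d i)⁻¹ := by
    ext i j
    simp [Matrix.mul_diagonal, Matrix.diagonal_mul]
  rw [this, Matrix.charpoly_mul_comm, ← mul_assoc, Matrix.diagonal_mul_diagonal]
  simp [hd]

/-- A bound on the quadratic form on a hyperplane bounds the second largest eigenvalue. -/
theorem eigenvalues₀_one_le {A : Matrix Ω Ω ℝ} (hA : A.IsHermitian) (w : EuclideanSpace ℝ Ω) {b : ℝ}
    (h : ∀ y : EuclideanSpace ℝ Ω, inner ℝ w y = 0 →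
      inner ℝ y (Matrix.toEuclideanLin A y) ≤ b * ‖y‖ ^ 2)
    (hcard : 1 < Fintype.card Ω) : hA.eigenvalues₀ ⟨1, hcard⟩ ≤ b := by
  set e : Fin (Fintype.card Ω) ≃ Ω := Fintype.equivOfCardEq (Fintype.card_fin _) with he
  have heig : ∀ k, hA.eigenvalues (e k) = hA.eigenvalues₀ k := fun k => by
    simp only [Matrix.IsHermitian.eigenvalues, ← he, Equiv.symm_apply_apply]
  set k₀ : Fin (Fintype.card Ω) := ⟨0, by omega⟩
  set k₁ : Fin (Fintype.card Ω) := ⟨1, hcard⟩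
  have hle : hA.eigenvalues₀ k₁ ≤ hA.eigenvalues₀ k₀ :=
    hA.eigenvalues₀_antitone (Fin.mk_le_mk.2 zero_le_one)
  have happ : ∀ k, Matrix.toEuclideanLin A (hA.eigenvectorBasis (e k)) =
      hA.eigenvalues₀ k • hA.eigenvectorBasis (e k) := fun k => by
    have := hA.mulVec_eigenvectorBasis (e k)
    rw [heig] at this
    exact congrArg (WithLp.toLp 2) this
  have hne : e k₀ ≠ e k₁ := fun hk => by
    simpa [k₀, k₁] using e.injective hk
  set v₀ := hA.eigenvectorBasis (e k₀) with hv₀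
  set v₁ := hA.eigenvectorBasis (e k₁) with hv₁
  have h00 : inner ℝ v₀ v₀ = (1 : ℝ) := by
    rw [real_inner_self_eq_norm_sq, hv₀, hA.eigenvectorBasis.orthonormal.1, one_pow]
  have h11 : inner ℝ v₁ v₁ = (1 : ℝ) := by
    rw [real_inner_self_eq_norm_sq, hv₁, hA.eigenvectorBasis.orthonormal.1, one_pow]
  have h01 : inner ℝ v₀ v₁ = (0 : ℝ) := hA.eigenvectorBasis.orthonormal.2 hne
  have h10 : inner ℝ v₁ v₀ = (0 : ℝ) := hA.eigenvectorBasis.orthonormal.2 hne.symm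
  -- Courant–Fischer: the plane of the top two eigenvectors meets the hyperplane `w⊥` in a nonzero
  -- vector, whose Rayleigh quotient is at least the second eigenvalue.
  obtain ⟨s, t, hst, hw⟩ : ∃ s t : ℝ, 0 < s ^ 2 + t ^ 2 ∧
      s * inner ℝ w v₀ + t * inner ℝ w v₁ = 0 := by
    by_cases h0 : (inner ℝ w v₀ : ℝ) = 0
    · exact ⟨1, 0, by norm_num, by rw [h0]; ring⟩
    · exact ⟨-inner ℝ w v₁, inner ℝ w v₀, by positivity, by ring⟩
  have key := h (s • v₀ + t • v₁) (by simpa [inner_add_right, inner_smul_right] using hw)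
  rw [← real_inner_self_eq_norm_sq] at key
  have happ₀ := happ k₀
  have happ₁ := happ k₁
  rw [← hv₀] at happ₀
  rw [← hv₁] at happ₁
  simp only [map_add, map_smul, happ₀, happ₁, inner_add_left, inner_add_right,
    real_inner_smul_left, real_inner_smul_right, h00, h11, h01, h10] at key
  have h2 := mul_le_mul_of_nonneg_left hle (sq_nonneg s)
  refine le_of_mul_le_mul_right (a := s ^ 2 + t ^ 2) ?_ hst
  linarith

/-- A Poincaré inequality for a reversible chain bounds its spectral gap from below. -/
theorem le_spectralGap {P : Matrix Ω Ω ℝ} {m : Ω → ℝ} (hm : ∀ i, 0 < m i)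
    (hrev : ∀ i j, m i * P i j = m j * P j i) {c : ℝ} (hc : c ≤ 1)
    (h : ∀ f : Ω → ℝ, ∑ i, m i * f i = 0 →
      ∑ i, ∑ j, m i * f i * P i j * f j ≤ (1 - c) * ∑ i, m i * f i ^ 2) :
    c ≤ spectralGap P := by
  have hs : ∀ i, √(m i) ≠ 0 := fun i => (Real.sqrt_pos.2 (hm i)).ne'
  have hsq : ∀ i, √(m i) * √(m i) = m i := fun i => Real.mul_self_sqrt (hm i).le
  set A : Matrix Ω Ω ℝ := Matrix.of fun i j => √(m i) * P i j * (√(m j))⁻¹ with hAdef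
  have hA : A.IsHermitian := by
    ext i j
    simp only [hAdef, Matrix.conjTranspose_apply, Matrix.of_apply, star_trivial]
    have hi := hs i
    have hj := hs j
    field_simp
    have := hrev i j
    rw [← hsq i, ← hsq j] at this
    linarith
  have hroots : P.charpoly.roots.sort (· ≥ ·) = List.ofFn hA.eigenvalues₀ := by
    rw [← hA.sort_roots_charpoly_eq_eigenvalues₀, hAdef, charpoly_diagonal_conj P _ hs]
    simp
  rw [spectralGap, secondEigenvalue, hroots]
  by_cases hcard : 1 < Fintype.card Ω
  · have : hA.eigenvalues₀ ⟨1, hcard⟩ ≤ 1 - c := by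
      -- With `f = y / √m`, orthogonality of `y` to `√m` says that `f` has mean zero.
      refine eigenvalues₀_one_le hA (WithLp.toLp 2 fun i => √(m i)) (fun y hy => ?_) hcard
      have hy0 : ∑ i, m i * (y i / √(m i)) = 0 := by
        rw [← hy]
        simp only [PiLp.inner_apply, RCLike.inner_apply, conj_trivial]
        refine Finset.sum_congr rfl fun i _ => ?_
        have := hs i
        field_simp
        rw [sq, hsq, mul_comm]
      have key := h _ hy0
      convert key using 1
      · simp only [PiLp.inner_apply, RCLike.inner_apply, conj_trivial, Matrix.toLpLin_apply,
          Matrix.mulVec, dotProduct, Finset.sum_mul]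
        refine Finset.sum_congr rfl fun i _ => Finset.sum_congr rfl fun j _ => ?_
        have hi := hs i
        have hj := hs j
        simp only [hAdef, Matrix.of_apply]
        field_simp
        rw [sq, hsq]
        ring
      · rw [EuclideanSpace.real_norm_sq_eq]
        congr 1
        refine Finset.sum_congr rfl fun i _ => ?_
        rw [div_pow, Real.sq_sqrt (hm i).le, mul_div_cancel₀ _ (hm i).ne']
    rw [List.getD_eq_getElem _ _ (by simpa using hcard), List.getElem_ofFn]
    linarith
  -- With at most one state the default `λ₂ = 0` applies, and `c ≤ 1` suffices.
  · rw [List.getD_eq_default _ _ (by simpa using hcard)]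
    linarith

end Gap

/-! ### Covariances, influences and the variance bound. -/

section Variance

variable {V : Type*} [Fintype V] [DecidableEq V]

/-- The influence matrix, on `V \ Λ`, of an unconditioned distribution `ν`. -/
noncomputable def influenceMatrix (ν : (V → ℤˣ) → ℝ) (Λ : Finset V) :
    Matrix {v : V // v ∉ Λ} {v : V // v ∉ Λ} ℝ :=
  Matrix.of fun u v =>
    if u = v then 0
    else ⨆ p : {p : ℤˣ × ℤˣ // 0 < marginalAt ν u.1 p.1 ∧ 0 < marginalAt ν u.1 p.2},
      dTV (marginalAt (pinnedAt ν u.1 p.1.1) v.1) (marginalAt (pinnedAt ν u.1 p.1.2) v.1)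

theorem influence_eq (μ : (V → ℤˣ) → ℝ) (Λ : Finset V) (σ : Λ → ℤˣ) :
    influence μ Λ σ = influenceMatrix (pinned μ Λ σ) Λ := rfl

theorem marginalAt_eq_sum_ite (ν : (V → ℤˣ) → ℝ) (v : V) (c : ℤˣ) :
    marginalAt ν v c = ∑ σ, if σ v = c then ν σ else 0 :=
  Finset.sum_filter _ _

theorem marginalAt_add (ν : (V → ℤˣ) → ℝ) (v : V) :
    marginalAt ν v 1 + marginalAt ν v (-1) = ∑ σ, ν σ := by
  rw [marginalAt_eq_sum_ite, marginalAt_eq_sum_ite, ← Finset.sum_add_distrib]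
  refine Finset.sum_congr rfl fun σ _ => ?_
  rcases Int.units_eq_one_or (σ v) with h | h <;> simp [h]

theorem sum_pinnedAt {ν : (V → ℤˣ) → ℝ} {u : V} {c : ℤˣ} (h : marginalAt ν u c ≠ 0) :
    ∑ σ, pinnedAt ν u c σ = 1 := by
  rw [← div_self h]
  conv_rhs => enter [1]; rw [marginalAt_eq_sum_ite]
  rw [Finset.sum_div]
  refine Finset.sum_congr rfl fun σ _ => ?_
  rw [pinnedAt]
  split_ifs <;> simp

theorem dTV_nonneg {α : Type*} [Fintype α] (p q : α → ℝ) : 0 ≤ dTV p q := by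
  unfold dTV; positivity

theorem dTV_marginalAt {ν ν' : (V → ℤˣ) → ℝ} (h : ∑ σ, ν σ = ∑ σ, ν' σ) (v : V) :
    dTV (marginalAt ν v) (marginalAt ν' v) = |marginalAt ν v 1 - marginalAt ν' v 1| := by
  have h1 := marginalAt_add ν v
  have h2 := marginalAt_add ν' v
  have h3 : marginalAt ν v (-1) - marginalAt ν' v (-1) =
      -(marginalAt ν v 1 - marginalAt ν' v 1) := by linarith
  rw [dTV, UnitsInt.univ, Finset.sum_insert (by decide), Finset.sum_singleton, h3, abs_neg]
  ring

theorem influenceMatrix_nonneg (ν : (V → ℤˣ) → ℝ) (Λ : Finset V) (u v : {v : V // v ∉ Λ}) :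
    0 ≤ influenceMatrix ν Λ u v := by
  rw [influenceMatrix, Matrix.of_apply]
  split_ifs
  · exact le_rfl
  · exact Real.iSup_nonneg fun _ => dTV_nonneg _ _

/-- The covariance of the indicators of `σ u = 1` and `σ v = 1`. -/
noncomputable def indicatorCov (ν : (V → ℤˣ) → ℝ) (u v : V) : ℝ :=
  (∑ σ, if σ u = 1 ∧ σ v = 1 then ν σ else 0) - marginalAt ν u 1 * marginalAt ν v 1

theorem marginalAt_nonneg {ν : (V → ℤˣ) → ℝ} (hν : ∀ σ, 0 ≤ ν σ) (v : V) (c : ℤˣ) :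
    0 ≤ marginalAt ν v c :=
  Finset.sum_nonneg fun σ _ => hν σ

/-- The covariance is `ν_u(+) ν_u(-)` times the difference of the conditional probabilities of `σ v
= 1`. For two spins that difference is, in modulus, the total variation distance, and `ν_u(-) ≤ 1`.
If `u` is deterministic, the covariance is zero. -/
theorem abs_indicatorCov_le {ν : (V → ℤˣ) → ℝ} (hν : ∀ σ, 0 ≤ ν σ) (hν1 : ∑ σ, ν σ = 1)
    {Λ : Finset V} {u v : {v : V // v ∉ Λ}} (huv : u ≠ v) :
    |indicatorCov ν u v| ≤ marginalAt ν u 1 * influenceMatrix ν Λ u v := by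
  set q : ℝ := ∑ σ : V → ℤˣ, if σ u = 1 ∧ σ v = 1 then ν σ else 0 with hq
  set q' : ℝ := ∑ σ : V → ℤˣ, if σ u = -1 ∧ σ v = 1 then ν σ else 0 with hq'
  have hqq : q + q' = marginalAt ν v 1 := by
    rw [hq, hq', marginalAt_eq_sum_ite, ← Finset.sum_add_distrib]
    refine Finset.sum_congr rfl fun σ _ => ?_
    rcases Int.units_eq_one_or (σ u) with h | h <;> simp [h]
  have hle : q ≤ marginalAt ν u 1 := by
    rw [hq, marginalAt_eq_sum_ite]
    refine Finset.sum_le_sum fun σ _ => ?_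
    have := hν σ
    split_ifs with h1 h2 h2
    · exact le_rfl
    · exact absurd h1.1 h2
    · exact this
    · exact le_rfl
  have hle' : q' ≤ marginalAt ν u (-1) := by
    rw [hq', marginalAt_eq_sum_ite]
    refine Finset.sum_le_sum fun σ _ => ?_
    have := hν σ
    split_ifs with h1 h2 h2
    · exact le_rfl
    · exact absurd h1.1 h2
    · exact this
    · exact le_rfl
  have hq0 : 0 ≤ q := Finset.sum_nonneg fun σ _ => by
    have := hν σ
    split_ifs <;> simp [this]
  have hq0' : 0 ≤ q' := Finset.sum_nonneg fun σ _ => by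
    have := hν σ
    split_ifs <;> simp [this]
  have hadd := marginalAt_add ν u.1
  rw [hν1] at hadd
  have hcov : indicatorCov ν u v =
      marginalAt ν u (-1) * q - marginalAt ν u 1 * q' := by
    rw [indicatorCov, ← hq, ← hqq]
    linear_combination -q * hadd
  rcases (marginalAt_nonneg hν u.1 1).eq_or_lt with h1 | h1
  · have : q = 0 := by linarith
    rw [hcov, ← h1, this]
    simp
  rcases (marginalAt_nonneg hν u.1 (-1)).eq_or_lt with h2 | h2
  · have : q' = 0 := by linarith
    rw [hcov, ← h2, this]
    simpa using mul_nonneg h1.le (influenceMatrix_nonneg ν Λ u v)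
  have hinf : |q / marginalAt ν u 1 - q' / marginalAt ν u (-1)| ≤ influenceMatrix ν Λ u v := by
    rw [influenceMatrix, Matrix.of_apply, if_neg huv]
    refine le_trans (le_of_eq ?_) (le_ciSup (f := fun p : {p : ℤˣ × ℤˣ //
      0 < marginalAt ν u.1 p.1 ∧ 0 < marginalAt ν u.1 p.2} =>
      dTV (marginalAt (pinnedAt ν u.1 p.1.1) v.1) (marginalAt (pinnedAt ν u.1 p.1.2) v.1))
      (Set.finite_range _).bddAbove ⟨(1, -1), h1, h2⟩)
    have hpin : ∀ c : ℤˣ, marginalAt (pinnedAt ν u c) v 1 =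
        (∑ σ, if σ u = c ∧ σ v = 1 then ν σ else 0) / marginalAt ν u c := fun c => by
      rw [marginalAt_eq_sum_ite, Finset.sum_div]
      refine Finset.sum_congr rfl fun σ _ => ?_
      rw [pinnedAt]
      by_cases ha : σ u = c <;> by_cases hb : σ v = 1 <;> simp [ha, hb]
    rw [dTV_marginalAt (by rw [sum_pinnedAt h1.ne', sum_pinnedAt h2.ne']), hpin, hpin]
  refine le_trans ?_ (mul_le_mul_of_nonneg_left hinf h1.le)
  have : indicatorCov ν u v = marginalAt ν u (-1) *
      (marginalAt ν u 1 * (q / marginalAt ν u 1 - q' / marginalAt ν u (-1))) := by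
    rw [hcov]; field_simp
  rw [this, abs_mul, abs_mul, abs_of_pos h1, abs_of_pos h2]
  exact mul_le_of_le_one_left (by positivity) (by linarith)

/-- Spectral independence bounds the variance of the conditional mean on revealing one `+1`. -/
theorem sum_marginalAt_mul_sq_le {ν : (V → ℤˣ) → ℝ} (hν : ∀ σ, 0 ≤ ν σ) (hν1 : ∑ σ, ν σ = 1)
    {Λ : Finset V} {η : ℝ} (hη : 0 ≤ η)
    (hρ : spectralRadius ℂ ((influenceMatrix ν Λ).map (fun x : ℝ => (x : ℂ))) ≤ ENNReal.ofReal η)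
    (f : (V → ℤˣ) → ℝ) :
    ∑ v : {v : V // v ∉ Λ}, marginalAt ν v 1 *
      ((∑ σ, if σ v = 1 then ν σ * f σ else 0) / marginalAt ν v 1 - ∑ σ, ν σ * f σ) ^ 2 ≤
      (1 + η) * (∑ σ, ν σ * f σ ^ 2 - (∑ σ, ν σ * f σ) ^ 2) := by
  set m := ∑ σ, ν σ * f σ with hm
  set p : {v : V // v ∉ Λ} → ℝ := fun v => marginalAt ν v 1 with hp
  set e : {v : V // v ∉ Λ} → ℝ := fun v => ∑ σ : V → ℤˣ, if σ v = 1 then ν σ * f σ else 0 with he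
  set x : {v : V // v ∉ Λ} → ℝ := fun v => e v / p v - m with hx
  let h : {v : V // v ∉ Λ} → (V → ℤˣ) → ℝ := fun v σ => (if σ v = 1 then 1 else 0) - p v
  have hp0 : ∀ v, 0 ≤ p v := fun v => marginalAt_nonneg hν _ _
  have hp1 : ∀ v, p v ≤ 1 := fun v => by
    have h1 := marginalAt_add ν v.1
    have h2 := marginalAt_nonneg hν v.1 (-1)
    simp only [hp]
    linarith
  have hpsum : ∀ v : {v : V // v ∉ Λ}, ∑ σ : V → ℤˣ, (if σ v = 1 then ν σ else 0) = p v :=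
    fun v => (marginalAt_eq_sum_ite ν v 1).symm
  -- The jump `x v` of the mean is the covariance of `f` with the indicator of `σ v = 1`, divided by
  -- `p v`.
  have hcovf : ∀ v, ∑ σ, ν σ * (f σ - m) * h v σ = p v * x v := fun v => by
    have h1 : ∑ σ, ν σ * (f σ - m) * h v σ = e v - p v * m := by
      have : ∀ σ, ν σ * (f σ - m) * h v σ = (if σ v = 1 then ν σ * f σ else 0) -
          m * (if σ v = 1 then ν σ else 0) - p v * (ν σ * f σ) + p v * m * ν σ := fun σ => by
        simp only [h]
        split_ifs <;> ring
      simp only [this, Finset.sum_add_distrib, Finset.sum_sub_distrib, ← Finset.mul_sum, hpsum,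
        hν1, ← hm, he]
      ring
    rw [h1]
    by_cases hv : p v = 0
    · have h2 : ∀ σ : V → ℤˣ, (if σ v = 1 then ν σ else 0) = 0 := fun σ => by
        have h3 := hpsum v
        rw [hv] at h3
        refine (Finset.sum_eq_zero_iff_of_nonneg fun σ _ => ?_).1 h3 σ (Finset.mem_univ _)
        have := hν σ
        split_ifs <;> simp [this]
      have h4 : e v = 0 := Finset.sum_eq_zero fun σ _ => by
        have := h2 σ
        split_ifs at this ⊢
        · rw [this, zero_mul]
        · rfl
      rw [h4, hv]; ring
    · simp only [hx]
      field_simp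
  have hcov : ∀ u v : {v : V // v ∉ Λ}, ∑ σ, ν σ * h u σ * h v σ = indicatorCov ν u v :=
    fun u v => by
    have : ∀ σ, ν σ * h u σ * h v σ = (if σ u = 1 ∧ σ v = 1 then ν σ else 0) -
        p v * (if σ u = 1 then ν σ else 0) - p u * (if σ v = 1 then ν σ else 0) +
        p u * p v * ν σ := fun σ => by
      simp only [h]
      by_cases ha : σ u = 1 <;> by_cases hb : σ v = 1 <;> simp [ha, hb] <;> ring
    simp only [this, Finset.sum_add_distrib, Finset.sum_sub_distrib, ← Finset.mul_sum, hpsum, hν1,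
      indicatorCov, hp]
    ring
  have hquad : ∑ u, ∑ v, x u * x v * indicatorCov ν u v ≤ (1 + η) * ∑ u, p u * x u ^ 2 := by
    refine quadForm_le_of_abs_le
      (C := Matrix.of fun u v : {v : V // v ∉ Λ} => indicatorCov ν u v) ?_ hp0 (fun u v => ?_)
      hη hρ (influenceMatrix_nonneg ν Λ) x
    · ext u v
      simp only [Matrix.transpose_apply, Matrix.of_apply, indicatorCov, and_comm, mul_comm]
    · rw [Matrix.of_apply, Matrix.add_apply]
      by_cases huv : u = v
      · subst huv
        have h0 : influenceMatrix ν Λ u u = 0 := by simp [influenceMatrix]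
        have h1 : indicatorCov ν u u = p u * (1 - p u) := by
          simp only [indicatorCov, and_self, hpsum]
          ring
        rw [h0, h1, Matrix.one_apply_eq, add_zero, mul_one,
          abs_of_nonneg (mul_nonneg (hp0 u) (by linarith [hp1 u]))]
        exact mul_le_of_le_one_right (hp0 u) (by linarith [hp0 u])
      · rw [Matrix.one_apply_ne huv, zero_add]
        exact abs_indicatorCov_le hν hν1 huv
  have hvar : ∑ σ, ν σ * (f σ - m) ^ 2 = ∑ σ, ν σ * f σ ^ 2 - m ^ 2 := by
    have : ∀ σ, ν σ * (f σ - m) ^ 2 = ν σ * f σ ^ 2 - 2 * m * (ν σ * f σ) + m ^ 2 * ν σ :=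
      fun σ => by ring
    simp only [this, Finset.sum_add_distrib, Finset.sum_sub_distrib, ← Finset.mul_sum, hν1, ← hm]
    ring
  -- The variance of `f - t ∑ v, x v * h v` is nonnegative.
  have hexp : ∀ t : ℝ, 0 ≤ ∑ σ, ν σ * f σ ^ 2 - m ^ 2 - 2 * t * ∑ v, p v * x v ^ 2 +
      t ^ 2 * ∑ u, ∑ v, x u * x v * indicatorCov ν u v := fun t => by
    have h1 : 0 ≤ ∑ σ, ν σ * (f σ - m - t * ∑ v, x v * h v σ) ^ 2 :=
      Finset.sum_nonneg fun σ _ => mul_nonneg (hν σ) (sq_nonneg _)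
    have h2 : ∀ σ, ν σ * (f σ - m - t * ∑ v, x v * h v σ) ^ 2 = ν σ * (f σ - m) ^ 2 -
        2 * t * ∑ v, x v * (ν σ * (f σ - m) * h v σ) +
        t ^ 2 * ∑ u, ∑ v, x u * x v * (ν σ * h u σ * h v σ) := fun σ => by
      have h3 : ∑ v, x v * (ν σ * (f σ - m) * h v σ) = ν σ * (f σ - m) * ∑ v, x v * h v σ := by
        rw [Finset.mul_sum]
        exact Finset.sum_congr rfl fun v _ => by ring
      have h4 : ∑ u, ∑ v, x u * x v * (ν σ * h u σ * h v σ) = ν σ * (∑ v, x v * h v σ) ^ 2 := by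
        rw [sq, Finset.sum_mul_sum, Finset.mul_sum]
        refine Finset.sum_congr rfl fun u _ => ?_
        rw [Finset.mul_sum]
        exact Finset.sum_congr rfl fun v _ => by ring
      rw [h3, h4]
      ring
    have h5 : ∑ σ, ∑ v, x v * (ν σ * (f σ - m) * h v σ) = ∑ v, p v * x v ^ 2 := by
      rw [Finset.sum_comm]
      refine Finset.sum_congr rfl fun v _ => ?_
      rw [← Finset.mul_sum, hcovf]
      ring
    have h6 : ∑ σ, ∑ u, ∑ v, x u * x v * (ν σ * h u σ * h v σ) =
        ∑ u, ∑ v, x u * x v * indicatorCov ν u v := by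
      rw [Finset.sum_comm]
      refine Finset.sum_congr rfl fun u _ => ?_
      rw [Finset.sum_comm]
      refine Finset.sum_congr rfl fun v _ => ?_
      rw [← Finset.mul_sum, hcov]
    simp only [h2, Finset.sum_add_distrib, Finset.sum_sub_distrib, ← Finset.mul_sum, h5, h6,
      hvar] at h1
    exact h1
  have hη1 : (0 : ℝ) < 1 + η := by linarith
  -- With the quadratic term bounded by `hquad`, this `t` minimises `-2 t + (1 + η) t²`.
  have key := hexp (1 + η)⁻¹
  have h7 := mul_le_mul_of_nonneg_left hquad (sq_nonneg (1 + η)⁻¹)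
  have h8 : (1 + η)⁻¹ ^ 2 * ((1 + η) * ∑ u, p u * x u ^ 2) =
      (1 + η)⁻¹ * ∑ u, p u * x u ^ 2 := by field_simp
  have h9 : (1 + η)⁻¹ * ∑ u, p u * x u ^ 2 ≤ ∑ σ, ν σ * f σ ^ 2 - m ^ 2 := by linarith
  rwa [inv_mul_le_iff₀ hη1] at h9

end Variance

/-! ### The field dynamics and its Poincaré inequality. -/

section Dynamics

variable {V : Type*} [Fintype V] [DecidableEq V]

theorem magnetize_denom_pos {μ : (V → ℤˣ) → ℝ} (hμ : μ ∈ stdSimplex ℝ (V → ℤˣ)) {θ : ℝ}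
    (hθ : 0 < θ) : 0 < ∑ τ : V → ℤˣ, μ τ * ∏ v with τ v = 1, θ := by
  obtain ⟨σ, -, hσ⟩ : ∃ σ ∈ Finset.univ, μ σ ≠ 0 :=
    Finset.exists_ne_zero_of_sum_ne_zero (by rw [hμ.2]; exact one_ne_zero)
  refine Finset.sum_pos' (fun τ _ => mul_nonneg (hμ.1 τ) (Finset.prod_nonneg fun _ _ => hθ.le))
    ⟨σ, Finset.mem_univ _, mul_pos (lt_of_le_of_ne (hμ.1 σ) hσ.symm)
      (Finset.prod_pos fun _ _ => hθ)⟩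

theorem ite_magnetize (μ : (V → ℤˣ) → ℝ) (θ : ℝ) (R : Finset V) (τ : V → ℤˣ) :
    (if ∀ v : R, τ v = 1 then magnetize μ (fun _ => θ) τ else 0) =
      θ ^ R.card / (∑ τ : V → ℤˣ, μ τ * ∏ v with τ v = 1, θ) * (μ τ * tilt θ R τ) := by
  split_ifs with h
  · have h' : ∀ v ∈ R, τ v = 1 := fun v hv => h ⟨v, hv⟩
    rw [magnetize, tilt, Finset.prod_filter, ← Finset.prod_mul_prod_compl R,
      Finset.prod_congr rfl fun v hv => if_pos (h' v hv), Finset.prod_const,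
      Finset.prod_eq_one fun v hv => if_pos (h' v hv)]
    ring
  · obtain ⟨v, hv⟩ := not_forall.1 h
    rw [tilt, Finset.prod_eq_zero v.2 (if_neg hv)]
    ring

theorem marginal_magnetize (μ : (V → ℤˣ) → ℝ) (θ : ℝ) (R : Finset V) :
    marginal (magnetize μ fun _ => θ) R (fun _ => 1) =
      θ ^ R.card / (∑ τ : V → ℤˣ, μ τ * ∏ v with τ v = 1, θ) * tiltSum μ θ R := by
  rw [marginal, Finset.sum_filter, tiltSum, Finset.mul_sum]
  exact Finset.sum_congr rfl fun τ _ => ite_magnetize μ θ R τ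

theorem pinned_magnetize {μ : (V → ℤˣ) → ℝ} (hμ : μ ∈ stdSimplex ℝ (V → ℤˣ)) {θ : ℝ}
    (hθ : 0 < θ) (R : Finset V) (τ : V → ℤˣ) :
    pinned (magnetize μ fun _ => θ) R (fun _ => 1) τ = μ τ * tilt θ R τ / tiltSum μ θ R := by
  have h : pinned (magnetize μ fun _ => θ) R (fun _ => 1) τ =
      (if ∀ v : R, τ v = 1 then magnetize μ (fun _ => θ) τ else 0) /
        marginal (magnetize μ fun _ => θ) R (fun _ => 1) := by
    rw [pinned]
    split_ifs <;> simp
  rw [h, ite_magnetize, marginal_magnetize]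
  exact mul_div_mul_left _ _ (div_pos (pow_pos hθ _) (magnetize_denom_pos hμ hθ)).ne'

theorem fieldDynamics_apply {μ : (V → ℤˣ) → ℝ} (hμ : μ ∈ stdSimplex ℝ (V → ℤˣ)) {θ : ℝ}
    (hθ : 0 < θ) (σ τ : {σ : V → ℤˣ // 0 < μ σ}) :
    fieldDynamics μ θ σ τ = ∑ R : Finset V, (1 - θ) ^ R.card * tilt θ R σ *
      (μ τ * tilt θ R τ / tiltSum μ θ R) := by
  rw [fieldDynamics, Matrix.of_apply]
  -- Reindex by `R = Sᶜ`, the spins that are kept.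
  refine Fintype.sum_equiv (compl_involutive.toPerm _) _ _ fun S => ?_
  simp only [Function.Involutive.coe_toPerm]
  have hsel : ∀ v, selectProb θ σ.1 v = if σ.1 v = 1 then θ else 1 := fun v => by
    rcases Int.units_eq_one_or (σ.1 v) with h | h <;> simp [selectProb, h]
  have hprod : (∏ v ∈ S, selectProb θ σ.1 v) * ∏ v ∈ Sᶜ, (1 - selectProb θ σ.1 v) =
      (1 - θ) ^ Sᶜ.card * tilt θ Sᶜ σ := by
    have h1 : ∀ v, 1 - selectProb θ σ.1 v = (1 - θ) * if σ.1 v = 1 then 1 else 0 := fun v => by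
      rw [hsel]; split_ifs <;> ring
    simp only [h1]
    simp only [hsel, tilt, compl_compl]
    rw [Finset.prod_mul_distrib, Finset.prod_const]
    ring
  rw [hprod]
  by_cases h : ∀ v ∈ Sᶜ, σ.1 v = 1
  · have : (fun v : (Sᶜ : Finset V) => σ.1 v) = fun _ => 1 := funext fun v => h v v.2
    rw [this, pinned_magnetize hμ hθ]
  -- A `-1` outside `S` has selection probability `1`, so such an `S` has weight zero.
  · rw [(tilt_eq_zero_iff hθ.ne' _ _).2 h]
    ring

theorem sum_support {μ : (V → ℤˣ) → ℝ} (hμ : ∀ σ, 0 ≤ μ σ) (k : (V → ℤˣ) → ℝ) :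
    ∑ σ : {σ : V → ℤˣ // 0 < μ σ}, μ σ * k σ = ∑ σ, μ σ * k σ := by
  have h := Finset.sum_subtype_eq_sum_filter (s := Finset.univ) (p := fun σ => 0 < μ σ)
    (fun σ => μ σ * k σ)
  rw [Finset.subtype_univ] at h
  rw [h]
  refine Finset.sum_filter_of_ne fun σ _ hσ => lt_of_le_of_ne (hμ σ) fun h0 => hσ ?_
  rw [← h0, zero_mul]

/-- At stationarity the old and new configurations are independent and identically distributed given
`R`, so each `R` contributes the square of a conditional mean. -/
theorem quadForm_fieldDynamics {μ : (V → ℤˣ) → ℝ} (hμ : μ ∈ stdSimplex ℝ (V → ℤˣ)) {θ : ℝ}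
    (hθ : 0 < θ) (f : (V → ℤˣ) → ℝ) :
    ∑ σ : {σ : V → ℤˣ // 0 < μ σ}, ∑ τ : {σ : V → ℤˣ // 0 < μ σ},
      μ σ * f σ * fieldDynamics μ θ σ τ * f τ = projSq μ f θ := by
  have hsum : ∀ R : Finset V, ∑ σ : {σ : V → ℤˣ // 0 < μ σ}, μ σ * (f σ * tilt θ R σ) =
      tiltSum (fun σ => μ σ * f σ) θ R := fun R => by
    rw [sum_support hμ.1 fun σ => f σ * tilt θ R σ, tiltSum]
    exact Finset.sum_congr rfl fun σ _ => by ring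
  have hterm : ∀ σ τ : {σ : V → ℤˣ // 0 < μ σ}, μ σ * f σ * fieldDynamics μ θ σ τ * f τ =
      ∑ R : Finset V, (1 - θ) ^ R.card / tiltSum μ θ R *
        (μ σ * (f σ * tilt θ R σ) * (μ τ * (f τ * tilt θ R τ))) := fun σ τ => by
    rw [fieldDynamics_apply hμ hθ, Finset.mul_sum, Finset.sum_mul]
    exact Finset.sum_congr rfl fun R _ => by ring
  simp only [hterm]
  rw [Finset.sum_congr rfl fun σ _ => Finset.sum_comm, Finset.sum_comm, projSq]
  refine Finset.sum_congr rfl fun R _ => ?_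
  simp only [← Finset.mul_sum]
  rw [← Finset.sum_mul, hsum]
  ring

/-- The rate at which revealing further `+1`s increases the second moment of the conditional mean is
at most `1 + η` times the conditional variance. -/
theorem sum_tiltSum_insert_mul_sq_le {μ : (V → ℤˣ) → ℝ} (hμ : μ ∈ stdSimplex ℝ (V → ℤˣ)) {η : ℝ}
    (hη : 0 ≤ η) (hSI : CompletelySpectrallyIndependent μ η) {θ : ℝ} (hθ : 0 < θ) (hθ1 : θ ≤ 1)
    (f : (V → ℤˣ) → ℝ) (R : Finset V) :
    θ * ∑ v ∈ Rᶜ, tiltSum μ θ (insert v R) *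
        (tiltSum (fun σ => μ σ * f σ) θ (insert v R) / tiltSum μ θ (insert v R) -
          tiltSum (fun σ => μ σ * f σ) θ R / tiltSum μ θ R) ^ 2 ≤
      (1 + η) * (tiltSum (fun σ => μ σ * f σ ^ 2) θ R -
        tiltSum (fun σ => μ σ * f σ) θ R ^ 2 / tiltSum μ θ R) := by
  rcases (tiltSum_nonneg hμ.1 hθ.le R).eq_or_lt with h0 | hZ
  · rw [tiltSum_mul_eq_zero hμ.1 hθ.le h0.symm f,
      tiltSum_mul_eq_zero hμ.1 hθ.le h0.symm fun σ => f σ ^ 2, ← h0, Finset.sum_eq_zero]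
    · simp
    · intro v hv
      rw [tiltSum_insert_eq_zero hμ.1 hθ h0.symm (by simpa using hv), zero_mul]
  set Z := tiltSum μ θ R with hZdef
  set ν : (V → ℤˣ) → ℝ := fun σ => μ σ * tilt θ R σ / Z with hν
  have hν0 : ∀ σ, 0 ≤ ν σ := fun σ =>
    div_nonneg (mul_nonneg (hμ.1 σ) (tilt_nonneg hθ.le R σ)) hZ.le
  have hν1 : ∑ σ, ν σ = 1 := by
    rw [hν, ← Finset.sum_div]
    exact div_self hZ.ne'
  have hνg : ∀ g : (V → ℤˣ) → ℝ, ∑ σ, ν σ * g σ = tiltSum (fun σ => μ σ * g σ) θ R / Z :=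
    fun g => by
    rw [tiltSum, Finset.sum_div]
    exact Finset.sum_congr rfl fun σ _ => by simp only [hν]; ring
  have hpin : pinned (magnetize μ fun _ => θ) R (fun _ => 1) = ν :=
    funext fun τ => pinned_magnetize hμ hθ R τ
  have hρ := hSI (fun _ => θ) (fun _ => ⟨hθ, hθ1⟩) R (fun _ => 1) (by
    rw [marginal_magnetize]
    exact mul_pos (div_pos (pow_pos hθ _) (magnetize_denom_pos hμ hθ)) hZ)
  rw [influence_eq, hpin] at hρ
  have key := mul_le_mul_of_nonneg_left (sum_marginalAt_mul_sq_le hν0 hν1 hη hρ f) hZ.le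
  rw [hνg, hνg] at key
  -- Inserting `v` into `R` conditions `ν` on `σ v = 1`, up to the factor `θ` of `tilt_insert`; this
  -- is the origin of the `θ` on the left of the claim.
  have hR : ∀ v ∉ R, θ * tiltSum μ θ (insert v R) = Z * marginalAt ν v 1 := fun v hv => by
    rw [mul_tiltSum_insert _ _ hv, marginalAt_eq_sum_ite, Finset.mul_sum]
    refine Finset.sum_congr rfl fun σ _ => ?_
    simp only [hν]
    split_ifs
    · field_simp
    · simp
  have hN : ∀ v ∉ R, θ * tiltSum (fun σ => μ σ * f σ) θ (insert v R) =
      Z * ∑ σ, if σ v = 1 then ν σ * f σ else 0 := fun v hv => by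
    rw [mul_tiltSum_insert _ _ hv, Finset.mul_sum]
    refine Finset.sum_congr rfl fun σ _ => ?_
    simp only [hν]
    split_ifs
    · field_simp
    · simp
  calc _ = Z * ∑ v : {v : V // v ∉ R}, marginalAt ν v 1 *
      ((∑ σ, if σ v = 1 then ν σ * f σ else 0) / marginalAt ν v 1 -
        tiltSum (fun σ => μ σ * f σ) θ R / Z) ^ 2 := by
        rw [Finset.sum_subtype (p := fun v => v ∉ R) Rᶜ (by simp), Finset.mul_sum, Finset.mul_sum]
        refine Finset.sum_congr rfl fun v _ => ?_
        rw [← mul_assoc, ← mul_assoc, hR v v.2, ← mul_div_mul_left _ (tiltSum μ θ _) hθ.ne',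
          hR v v.2, hN v v.2, mul_div_mul_left _ _ hZ.ne']
    _ ≤ _ := key
    _ = _ := by field_simp

/-- The Poincaré inequality for the field dynamics. -/
theorem projSq_le {μ : (V → ℤˣ) → ℝ} (hμ : μ ∈ stdSimplex ℝ (V → ℤˣ)) {η : ℝ}
    (hη : 0 ≤ η) (hSI : CompletelySpectrallyIndependent μ η) {θ : ℝ} (hθ : 0 < θ) (hθ1 : θ ≤ 1)
    {f : (V → ℤˣ) → ℝ} (hf : ∑ σ, μ σ * f σ = 0) :
    projSq μ f θ ≤ (1 - θ ^ (1 + η)) * ∑ σ, μ σ * f σ ^ 2 := by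
  set E := ∑ σ, μ σ * f σ ^ 2 with hE
  let D : ℝ → ℝ := fun t => ∑ R : Finset V, (1 - t) ^ R.card * ∑ v ∈ Rᶜ, tiltSum μ t (insert v R) *
    (tiltSum (fun σ => μ σ * f σ) t (insert v R) / tiltSum μ t (insert v R) -
      tiltSum (fun σ => μ σ * f σ) t R / tiltSum μ t R) ^ 2
  have hD : ∀ t, 0 < t → t ≤ 1 → t * D t ≤ (1 + η) * (E - projSq μ f t) := fun t ht ht1 => by
    rw [hE, ← sum_tiltSum _ t, projSq, ← Finset.sum_sub_distrib, Finset.mul_sum, Finset.mul_sum]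
    refine Finset.sum_le_sum fun R _ => ?_
    have := mul_le_mul_of_nonneg_left (sum_tiltSum_insert_mul_sq_le hμ hη hSI ht ht1 f R)
      (pow_nonneg (sub_nonneg.2 ht1) R.card)
    rw [← mul_sub]
    calc _ = _ := mul_left_comm _ _ _
      _ ≤ _ := this
      _ = _ := mul_left_comm _ _ _
  have hderiv : ∀ t, 0 < t → HasDerivAt (fun t => t ^ (-(1 + η)) * (E - projSq μ f t))
      (-(1 + η) * t ^ (-(1 + η) - 1) * (E - projSq μ f t) + t ^ (-(1 + η)) * D t) t :=
    fun t ht => by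
    have h1 := Real.hasDerivAt_rpow_const (x := t) (p := -(1 + η)) (Or.inl ht.ne')
    have h2 := (hasDerivAt_projSq hμ.1 f ht).const_sub E
    rw [neg_neg] at h2
    exact h1.mul h2
  -- Grönwall: `t ^ (-(1 + η))` is the integrating factor for `hD`.
  have hanti : AntitoneOn (fun t => t ^ (-(1 + η)) * (E - projSq μ f t)) (Set.Icc θ 1) := by
    refine antitoneOn_of_deriv_nonpos (convex_Icc θ 1)
      (fun t ht => (hderiv t (hθ.trans_le ht.1)).continuousAt.continuousWithinAt)
      (fun t ht => ?_) fun t ht => ?_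
    · rw [interior_Icc] at ht
      exact (hderiv t (hθ.trans ht.1)).differentiableAt.differentiableWithinAt
    · rw [interior_Icc] at ht
      have ht0 := hθ.trans ht.1
      rw [(hderiv t ht0).deriv]
      have h1 : t ^ (-(1 + η)) = t ^ (-(1 + η) - 1) * t := by
        rw [Real.rpow_sub_one ht0.ne', div_mul_cancel₀ _ ht0.ne']
      have h2 := mul_le_mul_of_nonneg_left (hD t ht0 ht.2.le)
        (Real.rpow_nonneg ht0.le (-(1 + η) - 1))
      rw [h1]
      linarith
  -- At `t = 1` only `R = ∅` has weight, and the unconditional mean of `f` is zero.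
  have hone : projSq μ f 1 = 0 := by
    rw [projSq, Finset.sum_eq_single ∅]
    · have : tiltSum (fun σ => μ σ * f σ) 1 ∅ = 0 := by
        simpa [tiltSum, tilt_one_empty] using hf
      rw [this]; simp
    · intro R _ hR
      rw [sub_self, zero_pow (Finset.card_ne_zero.2 (Finset.nonempty_iff_ne_empty.2 hR)), zero_mul]
    · simp
  have h := hanti (Set.left_mem_Icc.2 hθ1) (Set.right_mem_Icc.2 hθ1) hθ1
  simp only [Real.one_rpow, hone, one_mul, sub_zero] at h
  have hpos : 0 < θ ^ (1 + η) := Real.rpow_pos_of_pos hθ _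
  rw [Real.rpow_neg hθ.le, le_inv_mul_iff₀ hpos] at h
  linarith

theorem rpow_le_spectralGap_fieldDynamics {μ : (V → ℤˣ) → ℝ} (hμ : μ ∈ stdSimplex ℝ (V → ℤˣ))
    {η : ℝ} (hη : 0 ≤ η) (hSI : CompletelySpectrallyIndependent μ η) {θ : ℝ} (hθ : 0 < θ)
    (hθ1 : θ ≤ 1) : θ ^ (1 + η) ≤ spectralGap (fieldDynamics μ θ) := by
  refine le_spectralGap (m := fun σ : {σ : V → ℤˣ // 0 < μ σ} => μ σ) (fun σ => σ.2) (fun σ τ => ?_)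
    (Real.rpow_le_one hθ.le hθ1 (by linarith)) fun f hf => ?_
  · rw [fieldDynamics_apply hμ hθ, fieldDynamics_apply hμ hθ, Finset.mul_sum, Finset.mul_sum]
    exact Finset.sum_congr rfl fun R _ => by ring
  -- Extension by zero; values off the support carry no mass.
  · let F : (V → ℤˣ) → ℝ := fun σ => if h : 0 < μ σ then f ⟨σ, h⟩ else 0
    have hF : ∀ σ : {σ : V → ℤˣ // 0 < μ σ}, f σ = F σ := fun σ => by simp [F, σ.2]
    simp only [hF] at hf ⊢
    rw [sum_support hμ.1 F] at hf
    rw [quadForm_fieldDynamics hμ hθ F, sum_support hμ.1 fun σ => F σ ^ 2]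
    exact projSq_le hμ hη hSI hθ hθ1 hf

end Dynamics

end FieldDynamics

theorem lemma2p2 {V : Type*} [Fintype V] [DecidableEq V]
    (μ : (V → ℤˣ) → ℝ) (hμ : μ ∈ stdSimplex ℝ (V → ℤˣ))
    (η : ℝ) (hη : 0 < η) (hSI : FieldDynamics.CompletelySpectrallyIndependent μ η)
    (θ : ℝ) (hθ₀ : 0 < θ) (hθ₁ : θ < 1) :
    (θ / 2) ^ (2 * η + 7) ≤
      FieldDynamics.spectralGap (FieldDynamics.fieldDynamics μ θ) :=
  calc (θ / 2) ^ (2 * η + 7) ≤ θ ^ (2 * η + 7) :=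
        Real.rpow_le_rpow (by positivity) (by linarith) (by linarith)
    _ ≤ θ ^ (1 + η) := Real.rpow_le_rpow_of_exponent_ge hθ₀ hθ₁.le (by linarith)
    _ ≤ _ := FieldDynamics.rpow_le_spectralGap_fieldDynamics hμ hη.le hSI hθ₀ hθ₁.le
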